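/- All spaces are Tychonoff (completely regular and Hausdorff). For a space $X$, let $C_p(X)$ denote the space of all continuous functions $f:X\to\mathbb{R}$ with the topology of pointwise convergence. A space $X$ is called a $\kappa$-space if it is homeomorphic to a closed subspace of $C_p(Y)$ for some locally compact space $Y$. A space $X$ is realcompact if there is no Tychonoff space $Z$ containing $X$ as a proper dense subspace such that every continuous function $X\to\mathbb{R}$ extends to a continuous function $Z\to\mathbb{R}$. A space $K$ has countable tightness if whenever $a\in\overline{A}$ for $A\subseteq K$, there is a countable $A_0\subseteq A$ with $a\in\overline{A_0}$. Let $X$ be a Tychonoff space. (1) If every compact subset of $C_p(X)$ has countable tightness, then $X$ is a $\kappa$-space if and only if $X$ is realcompact. (2) If $X$ is a separable $\kappa$-space, then $X$ is realcompact. (3) If $X$ is a $\kappa$-space containing a dense subspace $Y$ such that $Y^n$ is Lindelöf for every $n\ge 1$, then $X$ is realcompact. -/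

import Mathlib

/-- `C_p(X)`: the continuous real-valued functions on `X` with the topology of pointwise
convergence, i.e. the subspace topology inherited from the product `X → ℝ`. -/
abbrev Cp (X : Type*) [TopologicalSpace X] : Type _ := {f : X → ℝ // Continuous f}

/-- Countable tightness: every point of the closure of a set `A` is in the closure of a countable
subset of `A`. -/
def CountablyTight (X : Type*) [TopologicalSpace X] : Prop :=
  ∀ (A : Set X) (a : X), a ∈ closure A → ∃ A₀ ⊆ A, A₀.Countable ∧ a ∈ closure A₀

/-- A `κ`-space: a Tychonoff space that is homeomorphic to a closed subspace of `C_p(Y)` for some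
locally compact (Hausdorff) space `Y`. -/
def IsKappaSpace.{u} (X : Type u) [TopologicalSpace X] : Prop :=
  T35Space X ∧
    ∃ (Y : Type u) (_ : TopologicalSpace Y) (_ : T2Space Y) (_ : LocallyCompactSpace Y)
      (e : X → Cp Y), Topology.IsClosedEmbedding e

/-- A realcompact space: a Tychonoff space `X` such that every dense embedding of `X` into a
Tychonoff space `Z` to which all continuous real-valued functions on `X` extend continuously
is onto. -/
def IsRealcompact.{u} (X : Type u) [TopologicalSpace X] : Prop :=
  T35Space X ∧
    ∀ (Z : Type u) [TopologicalSpace Z] [T35Space Z] (r : X → Z),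
      Topology.IsEmbedding r → DenseRange r →
      (∀ f : X → ℝ, Continuous f → ∃ g : Z → ℝ, Continuous g ∧ ∀ x, g (r x) = f x) →
      Function.Surjective r

open Topology Filter Set

/-! Let every continuous function on X extend to Z ⊇ X, fix z in Z, and let h(f) be the value at z
of the extension of f. On any countable family of functions h is evaluation at a point of X
(`exists_eq_of_countable_of_extends`), so h is continuous on countably tight compact subsets of
C_p(X). If X is closed in C_p(Y), each y in Y gives a function ev y on X, and local compactness of Y
makes φ(y) = h(ev y) continuous. Points of X tending to z converge pointwise on Y to φ, so
closedness puts φ in X, and φ is z.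

Conversely, a realcompact X is closed in a power of ℝ, which is C_p of a discrete space.

For (2) and (3), restriction to a dense subspace D embeds compact subsets of C_p(X) in C_p(D), which
is countably tight when all finite powers of D are Lindelöf. -/

theorem CountablyTight.of_isInducing {K T : Type*} [TopologicalSpace K] [TopologicalSpace T]
    (hT : CountablyTight T) {i : K → T} (hi : IsInducing i) : CountablyTight K := by
  intro A a ha
  rw [hi.closure_eq_preimage_closure_image] at ha
  obtain ⟨B, hBA, hB, haB⟩ := hT _ _ ha
  choose p hpA hp using fun b : B => hBA b.2
  refine ⟨range p, range_subset_iff.2 hpA, ?_, ?_⟩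
  · have := hB.to_subtype
    exact countable_range p
  · rwa [hi.closure_eq_preimage_closure_image, mem_preimage, ← range_comp, funext hp (f := i ∘ p),
      Subtype.range_coe]

/-- A real function which on every countable set agrees with a continuous function is continuous
if the domain is countably tight. -/
theorem CountablyTight.continuous_of_countable {K : Type*} [TopologicalSpace K]
    (hK : CountablyTight K) {h : K → ℝ}
    (hh : ∀ C : Set K, C.Countable → ∃ g : K → ℝ, Continuous g ∧ EqOn g h C) :
    Continuous h := by
  rw [continuous_iff_image_closure_subset_closure_image]
  rintro A _ ⟨a, ha, rfl⟩
  obtain ⟨B, hBA, hB, haB⟩ := hK A a ha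
  -- Including `a` makes the limit value `g a` equal to `h a`.
  obtain ⟨g, hg, hgh⟩ := hh (insert a B) (hB.insert a)
  rw [← hgh (mem_insert a B)]
  refine closure_mono ?_ (image_closure_subset_closure_image hg (mem_image_of_mem g haB))
  rintro _ ⟨b, hb, rfl⟩
  exact ⟨b, hBA hb, (hgh (mem_insert_of_mem a hb)).symm⟩

/-- If all finite powers of `Y` are Lindelöf, then `C_p(Y)` has countable tightness. -/
theorem countablyTight_cp_of_lindelofSpace_pow {Y : Type*} [TopologicalSpace Y]
    (hY : ∀ n : ℕ, LindelofSpace (Fin n → Y)) : CountablyTight (Cp Y) := by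
  intro A f hf
  -- For fixed `n` and `k`, one countable `B` must serve all `n`-tuples at once; this is where the
  -- Lindelöf property of the power is used.
  have key : ∀ n k : ℕ, ∃ B ⊆ A, B.Countable ∧
      ∀ y : Fin n → Y, ∃ g ∈ B, ∀ i, |g.1 (y i) - f.1 (y i)| < 1 / ((k : ℝ) + 1) := by
    intro n k
    have hk : (0 : ℝ) < 1 / ((k : ℝ) + 1) := by positivity
    have hex : ∀ y : Fin n → Y, ∃ g ∈ A, ∀ i, |g.1 (y i) - f.1 (y i)| < 1 / ((k : ℝ) + 1) := by
      intro y
      have hopen : IsOpen {g : Cp Y | ∀ i, |g.1 (y i) - f.1 (y i)| < 1 / ((k : ℝ) + 1)} := by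
        simp only [ofPred_forall]
        refine isOpen_iInter_of_finite fun i => isOpen_lt ?_ continuous_const
        exact (((continuous_apply (y i)).comp continuous_subtype_val).sub continuous_const).abs
      obtain ⟨g, hg, hgA⟩ := mem_closure_iff.1 hf _ hopen (by simpa using fun _ => by positivity)
      exact ⟨g, hgA, hg⟩
    choose G hGA hG using hex
    have hU : ∀ y : Fin n → Y,
        IsOpen {z : Fin n → Y | ∀ i, |(G y).1 (z i) - f.1 (z i)| < 1 / ((k : ℝ) + 1)} := by
      intro y
      simp only [ofPred_forall]
      refine isOpen_iInter_of_finite fun i => isOpen_lt ?_ continuous_const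
      exact (((G y).2.comp (continuous_apply i)).sub (f.2.comp (continuous_apply i))).abs
    have := hY n
    obtain ⟨S, hS, hSU⟩ := isLindelof_univ.elim_countable_subcover _ hU
      (fun y _ => mem_iUnion.2 ⟨y, hG y⟩)
    refine ⟨G '' S, image_subset_iff.2 fun y _ => hGA y, hS.image G, fun y => ?_⟩
    obtain ⟨z, hz, hyz⟩ := mem_iUnion₂.1 (hSU (mem_univ y))
    exact ⟨G z, mem_image_of_mem G hz, hyz⟩
  choose B hBA hB hBf using key
  refine ⟨⋃ n, ⋃ k, B n k, iUnion_subset fun n => iUnion_subset fun k => hBA n k,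
    countable_iUnion fun n => countable_iUnion fun k => hB n k, ?_⟩
  rw [closure_subtype, mem_closure_iff_nhds]
  intro U hU
  rw [nhds_pi, Filter.mem_pi] at hU
  obtain ⟨I, hI, t, ht, htU⟩ := hU
  have hε : ∃ k : ℕ, ∀ i ∈ I, Metric.ball (f.1 i) (1 / ((k : ℝ) + 1)) ⊆ t i := by
    have : ∀ᶠ k : ℕ in atTop, ∀ i ∈ I, Metric.ball (f.1 i) (1 / ((k : ℝ) + 1)) ⊆ t i := by
      rw [eventually_all_finite hI]
      intro i _
      obtain ⟨ε, hε, hεt⟩ := Metric.mem_nhds_iff.1 (ht i)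
      filter_upwards [tendsto_one_div_add_atTop_nhds_zero_nat.eventually (gt_mem_nhds hε)]
        with k hk
      exact (Metric.ball_subset_ball hk.le).trans hεt
    exact this.exists
  obtain ⟨k, hk⟩ := hε
  obtain ⟨n, y, hy⟩ : ∃ (n : ℕ) (y : Fin n → Y), range y = I := by
    have := hI.fintype
    exact ⟨_, fun j => ((Fintype.equivFin I).symm j : Y), by
      rw [range_comp' Subtype.val, (Fintype.equivFin I).symm.surjective.range_eq, image_univ,
        Subtype.range_coe]⟩
  obtain ⟨g, hg, hgf⟩ := hBf n k y
  refine ⟨g.1, htU fun i hi => hk i hi ?_,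
    mem_image_of_mem _ (mem_iUnion.2 ⟨n, mem_iUnion.2 ⟨k, hg⟩⟩)⟩
  obtain ⟨j, rfl⟩ := hy.symm ▸ hi
  simpa [Real.dist_eq] using hgf j

/-- Restriction to a dense subspace embeds compact sets of continuous functions. -/
theorem countablyTight_of_isCompact_of_dense {X : Type*} [TopologicalSpace X] {Y : Set X}
    (hY : Dense Y) (hT : CountablyTight (Cp Y)) (K : Set (Cp X)) (hK : IsCompact K) :
    CountablyTight K := by
  have := isCompact_iff_compactSpace.1 hK
  let ρ : K → Cp Y := fun g => ⟨fun y => g.1.1 y, g.1.2.comp continuous_subtype_val⟩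
  have hρ : Continuous ρ := by
    refine Continuous.subtype_mk (continuous_pi fun y => ?_) _
    exact (continuous_apply (y : X)).comp (continuous_subtype_val.comp continuous_subtype_val)
  have hinj : Function.Injective ρ := by
    intro g h hgh
    refine Subtype.ext (Subtype.ext (Continuous.ext_on hY g.1.2 h.1.2 fun y hy => ?_))
    exact congrFun (congrArg Subtype.val hgh) ⟨y, hy⟩
  -- A continuous injection of a compact space into a Hausdorff space is a closed embedding.
  exact hT.of_isInducing (hρ.isClosedEmbedding hinj).isInducing

/-- If all continuous real functions extend from the dense subspace `X` to `Z`, then every point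
of `Z` is indistinguishable from some point of `X` by countably many of them. -/
theorem exists_eq_of_countable_of_extends {X Z : Type*} [TopologicalSpace X] [TopologicalSpace Z]
    {r : X → Z} (hr : Continuous r) (hd : DenseRange r)
    (hext : ∀ f : X → ℝ, Continuous f → ∃ g : Z → ℝ, Continuous g ∧ ∀ x, g (r x) = f x)
    (z : Z) (g : ℕ → Z → ℝ) (hg : ∀ n, Continuous (g n)) :
    ∃ x, ∀ n, g n (r x) = g n z := by
  by_contra! hne
  -- The sum of the `u n` is continuous and vanishes exactly where every `g n` takes its value at
  -- `z`. If no point of X is such a zero, its reciprocal is continuous on X but cannot extend to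
  -- `z`.
  let u : ℕ → Z → ℝ := fun n w => min (|g n w - g n z|) 1 * (1 / 2) ^ n
  have hu0 : ∀ n w, 0 ≤ u n w := fun n w => by positivity
  have hule : ∀ n w, u n w ≤ (1 / 2) ^ n := fun n w =>
    mul_le_of_le_one_left (by positivity) (min_le_right _ _)
  have hus : ∀ w, Summable fun n => u n w := fun w =>
    Summable.of_nonneg_of_le (fun n => hu0 n w) (fun n => hule n w) summable_geometric_two
  let s : Z → ℝ := fun w => ∑' n, u n w
  have hs : Continuous s := by
    refine continuous_tsum (fun n => ?_) summable_geometric_two fun n w => ?_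
    · exact ((((hg n).sub continuous_const).abs).min continuous_const).mul continuous_const
    · rw [Real.norm_of_nonneg (hu0 n w)]
      exact hule n w
  have hsz : s z = 0 := by simp [s, u]
  have hspos : ∀ x, 0 < s (r x) := by
    intro x
    obtain ⟨n, hn⟩ := hne x
    refine (hus (r x)).tsum_pos (fun n => hu0 n _) n ?_
    have : 0 < |g n (r x) - g n z| := abs_pos.2 (sub_ne_zero.2 hn)
    positivity
  obtain ⟨q, hq, hqs⟩ := hext (fun x => (s (r x))⁻¹)
    ((hs.comp hr).inv₀ fun x => (hspos x).ne')
  have h1 : (fun w => q w * s w) = fun _ => 1 := by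
    refine hd.equalizer (hq.mul hs) continuous_const (funext fun x => ?_)
    simp [hqs, (hspos x).ne']
  have h2 := congrFun h1 z
  simp [hsz] at h2

/-- If all compact subsets of `C_p(X)` are countably tight, then a `κ`-space `X` is realcompact. -/
theorem IsKappaSpace.isRealcompact {X : Type*} [TopologicalSpace X]
    (hK : ∀ K : Set (Cp X), IsCompact K → CountablyTight K) (hX : IsKappaSpace X) :
    IsRealcompact X := by
  obtain ⟨hX35, Y, _, _, _, e, he⟩ := hX
  refine ⟨hX35, fun Z _ _ r hr hd hext z => ?_⟩
  choose E hEc hE using hext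
  let h : Cp X → ℝ := fun f => E f.1 f.2 z
  have hpt : ∀ C : Set (Cp X), C.Countable → ∃ x : X, ∀ f ∈ C, f.1 x = h f := by
    intro C hC
    rcases C.eq_empty_or_nonempty with rfl | hne
    · obtain ⟨x⟩ := hd.nonempty_iff.2 ⟨z⟩
      exact ⟨x, by simp⟩
    obtain ⟨c, rfl⟩ := hC.exists_eq_range hne
    obtain ⟨x, hx⟩ := exists_eq_of_countable_of_extends hr.continuous hd
      (fun f hf => ⟨E f hf, hEc f hf, hE f hf⟩) z (fun n => E (c n).1 (c n).2)
      fun n => hEc _ _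
    refine ⟨x, ?_⟩
    rintro _ ⟨n, rfl⟩
    rw [← hE (c n).1 (c n).2 x]
    exact hx n
  let ev : Y → Cp X := fun y => ⟨fun x => (e x).1 y,
    (continuous_apply y).comp (continuous_subtype_val.comp he.continuous)⟩
  have hev : Continuous ev := Continuous.subtype_mk (continuous_pi fun x => (e x).2) _
  have hφ : Continuous fun y => h (ev y) := by
    rw [continuous_iff_continuousAt]
    intro y
    -- Continuity of `h` is available only on compact sets, so it is applied to the image of a
    -- compact neighbourhood of `y`.
    obtain ⟨L, hL, hyL⟩ := exists_compact_mem_nhds y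
    have hcomp : IsCompact (ev '' L) := hL.image hev
    have hcont : ContinuousOn h (ev '' L) := by
      rw [continuousOn_iff_continuous_domRestrict]
      refine (hK _ hcomp).continuous_of_countable fun C hC => ?_
      obtain ⟨x, hx⟩ := hpt (Subtype.val '' C) (hC.image _)
      exact ⟨fun f => f.1.1 x,
        (continuous_apply x).comp (continuous_subtype_val.comp continuous_subtype_val),
        fun f hf => hx f.1 (mem_image_of_mem _ hf)⟩
    exact (hcont.comp hev.continuousOn (mapsTo_image ev L)).continuousAt hyL
  let φ : Cp Y := ⟨_, hφ⟩
  have : (comap r (𝓝 z)).NeBot := (IsDenseInducing.mk hr.isInducing hd).comap_nhds_neBot z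
  have hlim : Tendsto e (comap r (𝓝 z)) (𝓝 φ) := by
    rw [tendsto_subtype_rng, tendsto_pi_nhds]
    intro y
    have := ((hEc (ev y).1 (ev y).2).tendsto z).comp (tendsto_comap (f := r))
    exact this.congr fun x => hE _ _ x
  obtain ⟨x, hx⟩ : φ ∈ range e :=
    he.isClosed_range.mem_of_tendsto hlim (Eventually.of_forall mem_range_self)
  -- Since `e` is an embedding, convergence of `e` to `e x` is convergence to `x` in X; then `r x`
  -- and `z` are limits of `r` along the same filter.
  have hlim' : Tendsto id (comap r (𝓝 z)) (𝓝 x) := by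
    rw [he.isInducing.nhds_eq_comap, tendsto_comap_iff, hx]
    exact hlim
  exact ⟨x, tendsto_nhds_unique ((hr.continuous.tendsto x).comp hlim') tendsto_comap⟩

/-- A closed subspace of a power of `ℝ` is a `κ`-space. -/
theorem isKappaSpace_of_isClosedEmbedding_pi.{u} {X ι : Type u} [TopologicalSpace X] [T35Space X]
    {j : X → ι → ℝ} (hj : IsClosedEmbedding j) : IsKappaSpace X := by
  -- With the discrete topology `ι` is locally compact and every function on it is continuous, so
  -- C_p(ι) is the whole power of ℝ.
  let _ : TopologicalSpace ι := ⊥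
  have : DiscreteTopology ι := ⟨rfl⟩
  refine ⟨inferInstance, ι, ⊥, inferInstance, inferInstance,
    fun x => ⟨j x, continuous_of_discreteTopology⟩, hj.isEmbedding.codRestrict _ _, ?_⟩
  convert hj.isClosed_range.preimage continuous_subtype_val using 1
  ext g
  simp [Subtype.ext_iff]

theorem isEmbedding_eval_cp (X : Type*) [TopologicalSpace X] [T35Space X] :
    IsEmbedding fun (x : X) (f : Cp X) => f.1 x := by
  refine IsInducing.isEmbedding (isInducing_iff_nhds.2 fun x => le_antisymm ?_ ?_)
  · exact (continuous_pi fun f : Cp X => f.2).continuousAt.le_comap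
  · intro U hU
    obtain ⟨V, hVU, hV, hxV⟩ := mem_nhds_iff.1 hU
    obtain ⟨f, hf, hfx, hfV⟩ := CompletelyRegularSpace.completely_regular_isOpen x V hV hxV
    let F : Cp X := ⟨fun y => f y, continuous_subtype_val.comp hf⟩
    refine ⟨{p | p F < 1}, (isOpen_lt (continuous_apply F) continuous_const).mem_nhds ?_, ?_⟩
    · simp [F, hfx]
    · intro y hy
      by_contra hyU
      have h1 : f y = 1 := hfV fun hyV => hyU (hVU hyV)
      simp [F, h1] at hy

/-- In the closure of the image of X under all evaluations, each continuous function extends as a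
coordinate projection. Realcompactness thus forces that image to be closed. -/
theorem IsRealcompact.isKappaSpace {X : Type*} [TopologicalSpace X] (hX : IsRealcompact X) :
    IsKappaSpace X := by
  obtain ⟨_, hX⟩ := hX
  let j : X → Cp X → ℝ := fun x f => f.1 x
  have hj : IsEmbedding j := isEmbedding_eval_cp X
  let r : X → closure (range j) := fun x => ⟨j x, subset_closure (mem_range_self x)⟩
  have hd : DenseRange r := by
    intro w
    rw [closure_subtype, ← range_comp]
    exact w.2
  have hsurj := hX (closure (range j)) r (hj.codRestrict _ _) hd fun f hf =>
    ⟨fun w => w.1 ⟨f, hf⟩, (continuous_apply _).comp continuous_subtype_val, fun x => rfl⟩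
  refine isKappaSpace_of_isClosedEmbedding_pi ⟨hj, isClosed_of_closure_subset fun w hw => ?_⟩
  obtain ⟨x, hx⟩ := hsurj ⟨w, hw⟩
  exact ⟨x, congrArg Subtype.val hx⟩

theorem theoremt {X : Type*} [TopologicalSpace X] [T35Space X] :
    ((∀ K : Set (Cp X), IsCompact K → CountablyTight K) →
      (IsKappaSpace X ↔ IsRealcompact X)) ∧
    (TopologicalSpace.SeparableSpace X → IsKappaSpace X → IsRealcompact X) ∧
    ((∃ Y : Set X, Dense Y ∧ ∀ n : ℕ, 1 ≤ n → LindelofSpace (Fin n → Y)) →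
      IsKappaSpace X → IsRealcompact X) := by
  have h3 : (∃ Y : Set X, Dense Y ∧ ∀ n : ℕ, 1 ≤ n → LindelofSpace (Fin n → Y)) →
      IsKappaSpace X → IsRealcompact X := by
    rintro ⟨Y, hY, hL⟩ hX
    refine hX.isRealcompact (countablyTight_of_isCompact_of_dense hY
      (countablyTight_cp_of_lindelofSpace_pow fun n => ?_))
    rcases n.eq_zero_or_pos with rfl | hn
    · infer_instance
    · exact hL n hn
  refine ⟨fun hK => ⟨fun hX => hX.isRealcompact hK, fun hX => hX.isKappaSpace⟩,
    fun hS hX => h3 ?_ hX, h3⟩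
  obtain ⟨D, hDc, hD⟩ := TopologicalSpace.exists_countable_dense X
  have := hDc.to_subtype
  -- Finite powers of a countable space are countable, hence Lindelöf.
  exact ⟨D, hD, fun n _ => inferInstance⟩
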